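/- For coprime positive integers $p,q$ let $(p',q')\in\mathbb N^2$ be the unique pair with $pp'-qq'=1$, $p'\le q$ and $q'<p$. For $\mu\in\mathbb C^*$, the Newton map $\sigma_{(p,q,\mu)}$ is the $\mathbb C$-algebra homomorphism $$\sigma_{(p,q,\mu)}:\mathbb C[[x,y]]\to\mathbb C[[x,y]],\qquad f(x,y)\mapsto f\bigl(\mu^{q'}x^p,\;x^q(y+\mu^{p'})\bigr).$$ For an ideal $I$ of $\mathbb C[[x,y]]$ and a Newton map $\sigma$, let $I_\sigma$ be the ideal generated by $\sigma(I)$; for a finite sequence $\Sigma_n=(\sigma_1,\dots,\sigma_n)$ of Newton maps put $I_{\Sigma_n}=(\cdots((I_{\sigma_1})_{\sigma_2})\cdots)_{\sigma_n}$ (and $I_{\Sigma_0}=I$). **Theorem.** Let $I$ be a nonzero ideal of $\mathbb C[[x,y]]$. 1. There is an integer $n_0\ge 0$ (depending on $I$) such that, for every $n\ge n_0$ and every sequence $\Sigma_n$ of $n$ Newton maps, the ideal $I_{\Sigma_n}$ is principal, generated by $x^k(y+h(x))^\nu$ for some $h\in x\mathbb C[[x]]$ and $(k,\nu)\in\mathbb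 N\times\mathbb N$. 2. Consequently the depth $d(I)\in\mathbb N$ is well defined by the following recursion: $d(I)=0$ if $I$ is generated by $x^k(y+h(x))^\nu$ for some $h\in x\mathbb C[[x]]$ and $(k,\nu)\in\mathbb N\times\mathbb N$; otherwise $d(I)=\max_\sigma d(I_\sigma)+1$, the maximum being taken over all Newton maps $\sigma$. That is, the recursion stops, all the maxima involved exist, and exactly one natural number is assigned to $I$. -/

import Mathlib

/-- The ring `ℂ[[x, y]]`, with `x = X 0` and `y = X 1`. -/
abbrev PS2 : Type := MvPowerSeries (Fin 2) ℂ

/-- The data of a Newton map `σ_{(p,q,μ)}`: positive integers `p, q`, a nonzero `μ`, and the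
natural numbers `p', q'` (written `p₁, q₁`) with `p p' - q q' = 1`, normalized by `p' ≤ q` and
`q' < p`, which makes them unique. The equation forces `gcd (p, q) = 1`. -/
structure NewtonDatum where
  p : ℕ
  q : ℕ
  p₁ : ℕ
  q₁ : ℕ
  μ : ℂ
  p_pos : 0 < p
  q_pos : 0 < q
  bezout : p * p₁ = q * q₁ + 1
  p₁_le : p₁ ≤ q
  q₁_lt : q₁ < p
  μ_ne : μ ≠ 0

namespace NewtonDatum

/-- The pair `(μ^{q'} x^p, x^q (y + μ^{p'}))` substituted for `(x, y)`. -/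
noncomputable def substitution (σ : NewtonDatum) : Fin 2 → PS2 :=
  ![MvPowerSeries.C (σ.μ ^ σ.q₁) * MvPowerSeries.X 0 ^ σ.p,
    MvPowerSeries.X 0 ^ σ.q * (MvPowerSeries.X 1 + MvPowerSeries.C (σ.μ ^ σ.p₁))]

theorem hasSubst_substitution (σ : NewtonDatum) : MvPowerSeries.HasSubst σ.substitution := by
  apply MvPowerSeries.hasSubst_of_constantCoeff_zero
  intro i
  fin_cases i
  · simp [substitution, σ.p_pos.ne']
  · simp [substitution, σ.q_pos.ne']

/-- The Newton map `f(x, y) ↦ f(μ^{q'} x^p, x^q (y + μ^{p'}))`. -/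
noncomputable def newtonMap (σ : NewtonDatum) : PS2 →ₐ[ℂ] PS2 :=
  MvPowerSeries.substAlgHom σ.hasSubst_substitution

end NewtonDatum

/-- `I_σ`, the ideal generated by the image of `I` under the Newton map `σ`. -/
noncomputable def Ideal.newtonTransform (I : Ideal PS2) (σ : NewtonDatum) : Ideal PS2 :=
  I.map σ.newtonMap

/-- `I_Σ` for a finite sequence `Σ = (σ₁, …, σₙ)` of Newton maps, `σ₁` being applied first. -/
noncomputable def Ideal.newtonTransformSeq (I : Ideal PS2) (S : List NewtonDatum) : Ideal PS2 :=
  S.foldl Ideal.newtonTransform I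

/-- `I` is principal, generated by `x^k (y + h(x))^ν` for some `k, ν ∈ ℕ` and `h ∈ x ℂ[[x]]`. -/
def Ideal.IsNewtonFinal (I : Ideal PS2) : Prop :=
  ∃ (k ν : ℕ) (h : PowerSeries ℂ), PowerSeries.X ∣ h ∧
    I = Ideal.span {(MvPowerSeries.X 0 : PS2) ^ k *
      (MvPowerSeries.X 1 + PowerSeries.subst (MvPowerSeries.X 0 : PS2) h) ^ ν}

/-- `I.HasNewtonDepth d` says that the recursion defining the depth of `I` assigns to `I` the
value `d`: the value is `0` if `I` is generated by some `x^k (y + h(x))^ν`; otherwise, each `I_σ`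
has a depth `D σ`, the maximum `m` of `D` over all Newton maps exists, and the value is `m + 1`. -/
inductive Ideal.HasNewtonDepth : Ideal PS2 → ℕ → Prop
  | zero (I : Ideal PS2) (hI : I.IsNewtonFinal) : Ideal.HasNewtonDepth I 0
  | succ (I : Ideal PS2) (hI : ¬ I.IsNewtonFinal) (D : NewtonDatum → ℕ) (m : ℕ)
      (hD : ∀ σ, Ideal.HasNewtonDepth (I.newtonTransform σ) (D σ))
      (hm : IsGreatest (Set.range D) m) : Ideal.HasNewtonDepth I (m + 1)

/-!
Write `f = x ^ k g` with `g` not divisible by `x`, and let `ν` be the order of `g(0, y)`. After a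
Newton map `σ`, the new value of `ν` is the multiplicity of `μ ^ p'` as a root of the polynomial
carried by one compact face of the Newton polygon of `f`, so it is at most the degree of that
polynomial, which is at most `ν`. Only finitely many `σ` make that multiplicity positive: `(p, q)`
has to be the slope of an edge of the polygon, and `μ` a root of a nonzero polynomial. If `ν > 0`
is unchanged, then the face polynomial is a constant times `(y - μ ^ p') ^ ν`; its coefficients of
all degrees `≤ ν` are nonzero, so `p = 1`.

Along an infinite sequence of Newton maps the `ν` of each member of a finite set of generators
stabilizes. A series with constant `ν` is `x ^ k (y - b) ^ ν` times a unit, where the branch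
`b(x) = x ^ q₀ (μ₀ + x ^ q₁ (μ₁ + ⋯))` depends only on the sequence. The exponent `k` becomes
`p k + q ν`, so a generator with the least `ν` eventually has the least `k` too and generates the
ideal. Thus no sequence avoids the ideals `(x ^ k (y + h(x)) ^ ν)` forever, and each ideal has only
finitely many transforms not of this form: both claims follow by well-founded induction.
-/

open MvPowerSeries

namespace NewtonTree

section Orders

variable {R : Type*} [Semiring R] {f : MvPowerSeries (Fin 2) R} {d : Fin 2 →₀ ℕ}

/-- The order of `f(x, y)` in `x`: the least exponent of `x` in the support of `f`, with junk value
`0` at `f = 0`. -/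
noncomputable def xOrder (f : MvPowerSeries (Fin 2) R) : ℕ :=
  sInf {a | ∃ d, coeff d f ≠ 0 ∧ d 0 = a}

/-- The order in `y` of the coefficient of `x ^ xOrder f` in `f(x, y)`, that is, of the restriction
to `x = 0` of `x ^ (-xOrder f) f(x, y)`, with junk value `0` at `f = 0`. -/
noncomputable def yOrder (f : MvPowerSeries (Fin 2) R) : ℕ :=
  sInf {b | ∃ d, coeff d f ≠ 0 ∧ d 0 = xOrder f ∧ d 1 = b}

theorem xOrder_le (hd : coeff d f ≠ 0) : xOrder f ≤ d 0 :=
  Nat.sInf_le ⟨d, hd, rfl⟩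

theorem yOrder_le (hd : coeff d f ≠ 0) (hd₀ : d 0 = xOrder f) : yOrder f ≤ d 1 :=
  Nat.sInf_le ⟨d, hd, hd₀, rfl⟩

theorem exists_coeff_ne_zero_of_orders (hf : f ≠ 0) :
    ∃ d, coeff d f ≠ 0 ∧ d 0 = xOrder f ∧ d 1 = yOrder f := by
  obtain ⟨d, hd⟩ := (ne_zero_iff_exists_coeff_ne_zero f).1 hf
  have hx : xOrder f ∈ {a | ∃ d, coeff d f ≠ 0 ∧ d 0 = a} := Nat.sInf_mem ⟨d 0, d, hd, rfl⟩
  obtain ⟨e, he, he₀⟩ := hx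
  exact Nat.sInf_mem (s := {b | ∃ d, coeff d f ≠ 0 ∧ d 0 = xOrder f ∧ d 1 = b})
    ⟨e 1, e, he, he₀, rfl⟩

theorem X_zero_pow_dvd_iff (hf : f ≠ 0) {k : ℕ} : X 0 ^ k ∣ f ↔ k ≤ xOrder f := by
  rw [X_pow_dvd_iff]
  constructor
  · intro h
    obtain ⟨d, hd, hd₀, -⟩ := exists_coeff_ne_zero_of_orders hf
    by_contra! hk
    exact hd (h d (hd₀ ▸ hk))
  · intro hk d hd
    by_contra h
    exact hd.not_ge (hk.trans (xOrder_le h))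

end Orders

theorem X_zero_pow_mul_X_one_pow_dvd {R : Type*} [CommSemiring R] {f : MvPowerSeries (Fin 2) R}
    {k ν : ℕ} (h₀ : X 0 ^ k ∣ f) (h₁ : X 1 ^ ν ∣ f) : X 0 ^ k * X 1 ^ ν ∣ f := by
  obtain ⟨g, rfl⟩ := h₀
  refine mul_dvd_mul_left _ (X_pow_dvd_iff.2 fun d hd => ?_)
  have hcoeff := X_pow_dvd_iff.1 h₁ (Finsupp.single 0 k + d) (by simpa using hd)
  rwa [X_pow_eq, coeff_add_monomial_mul, one_mul] at hcoeff

theorem coeff_X_zero_pow_mul_X_one_add_pow_mul {R : Type*} [CommRing R]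
    {h W : MvPowerSeries (Fin 2) R} (hh : X 0 ∣ h) (k ν : ℕ) :
    coeff (Finsupp.single 0 k + Finsupp.single 1 ν) (X 0 ^ k * (X 1 + h) ^ ν * W) =
      constantCoeff W := by
  have hpow : X 0 ∣ (X 1 + h) ^ ν - X 1 ^ ν :=
    (hh.trans (add_sub_cancel_left (X 1) h).symm.dvd).trans (sub_dvd_pow_sub_pow _ _ ν)
  have hdvd : X 0 ^ (k + 1) ∣ X 0 ^ k * (X 1 + h) ^ ν * W - X 0 ^ k * X 1 ^ ν * W := by
    rw [← sub_mul, ← mul_sub, pow_succ]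
    exact (mul_dvd_mul_left _ hpow).mul_right _
  have hcoeff := X_pow_dvd_iff.1 hdvd (Finsupp.single 0 k + Finsupp.single 1 ν) (by simp)
  rw [map_sub, sub_eq_zero] at hcoeff
  rw [hcoeff, X_pow_eq, X_pow_eq, monomial_mul_monomial, one_mul]
  simpa using coeff_add_monomial_mul (Finsupp.single 0 k + Finsupp.single 1 ν) 0 W (1 : R)

section Field

variable {K : Type*} [Field K] {f h : MvPowerSeries (Fin 2) K}

theorem associated_of_X_zero_pow_mul_X_one_add_pow_dvd (hf : f ≠ 0) (hh : X 0 ∣ h)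
    (hdvd : X 0 ^ xOrder f * (X 1 + h) ^ yOrder f ∣ f) :
    Associated (X 0 ^ xOrder f * (X 1 + h) ^ yOrder f) f := by
  obtain ⟨W, hW⟩ := hdvd
  obtain ⟨d, hd, hd₀, hd₁⟩ := exists_coeff_ne_zero_of_orders hf
  have hd_eq : d = Finsupp.single 0 (xOrder f) + Finsupp.single 1 (yOrder f) := by
    ext i; fin_cases i <;> simp [hd₀, hd₁]
  have hW₀ : constantCoeff W ≠ 0 := by
    rwa [← coeff_X_zero_pow_mul_X_one_add_pow_mul hh (xOrder f) (yOrder f), ← hW, ← hd_eq]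
  obtain ⟨w, rfl⟩ := isUnit_iff_constantCoeff.2 hW₀.isUnit
  exact ⟨w, hW.symm⟩

theorem associated_X_zero_pow_of_yOrder_eq_zero (hf : f ≠ 0) (hy : yOrder f = 0) :
    Associated (X 0 ^ xOrder f) f := by
  have hdvd := (X_zero_pow_dvd_iff hf).2 le_rfl
  simpa [hy] using associated_of_X_zero_pow_mul_X_one_add_pow_dvd hf (dvd_zero _) (by simpa [hy])

end Field

section Face

variable {R : Type*} [CommRing R] {p q N : ℕ} {d e : Fin 2 →₀ ℕ}

/-- The exponents `(a, b)` on the line `p a + q b = N`. The box `[0, N] × [0, N]` only serves to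
make this a finite set: it contains the whole line as soon as `p` and `q` are positive. -/
noncomputable def face (p q N : ℕ) : Finset (Fin 2 →₀ ℕ) :=
  {d ∈ Finset.Iic (Finsupp.equivFunOnFinite.symm fun _ => N) | p * d 0 + q * d 1 = N}

theorem weight_eq_of_mem_face (hd : d ∈ face p q N) : p * d 0 + q * d 1 = N :=
  (Finset.mem_filter.1 hd).2

theorem mem_face (hp : 0 < p) (hq : 0 < q) : d ∈ face p q N ↔ p * d 0 + q * d 1 = N := by
  refine ⟨weight_eq_of_mem_face, fun h => Finset.mem_filter.2 ⟨Finset.mem_Iic.2 fun i => ?_, h⟩⟩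
  have hd₀ : d 0 ≤ p * d 0 := Nat.le_mul_of_pos_left _ hp
  have hd₁ : d 1 ≤ q * d 1 := Nat.le_mul_of_pos_left _ hq
  fin_cases i
  exacts [hd₀.trans (h ▸ Nat.le_add_right _ _), hd₁.trans (h ▸ Nat.le_add_left _ _)]

theorem face_injOn (hp : 0 < p) : Set.InjOn (fun d : Fin 2 →₀ ℕ => d 1) (face p q N) := by
  intro d hd e he hde
  have hde₁ : d 1 = e 1 := hde
  have hde₀ : p * d 0 = p * e 0 := by
    have := weight_eq_of_mem_face hd
    have := weight_eq_of_mem_face he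
    rw [hde₁] at *
    omega
  ext i
  fin_cases i
  exacts [Nat.eq_of_mul_eq_mul_left hp hde₀, hde₁]

/-- The restriction of `f(u, t)` to the monomials on the line `p a + q b = N`, as a polynomial
in `t`. -/
noncomputable def facePoly (p q : ℕ) (u : R) (N : ℕ) (f : MvPowerSeries (Fin 2) R) :
    Polynomial R :=
  ∑ d ∈ face p q N, Polynomial.monomial (d 1) (coeff d f * u ^ d 0)

theorem coeff_facePoly_of_mem (hp : 0 < p) (hd : d ∈ face p q N) (u : R)
    (f : MvPowerSeries (Fin 2) R) : (facePoly p q u N f).coeff (d 1) = coeff d f * u ^ d 0 := by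
  simp only [facePoly, Polynomial.finsetSum_coeff, Polynomial.coeff_monomial]
  rw [Finset.sum_eq_single_of_mem d hd fun e he hed =>
    if_neg fun h => hed (face_injOn hp he hd h), if_pos rfl]

theorem exists_mem_face_of_coeff_facePoly_ne_zero {u : R} {f : MvPowerSeries (Fin 2) R} {b : ℕ}
    (hb : (facePoly p q u N f).coeff b ≠ 0) : ∃ d ∈ face p q N, d 1 = b ∧ coeff d f ≠ 0 := by
  rw [facePoly, Polynomial.finsetSum_coeff] at hb
  obtain ⟨d, hd, hdb⟩ := Finset.exists_ne_zero_of_sum_ne_zero hb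
  rw [Polynomial.coeff_monomial] at hdb
  exact ⟨d, hd, of_not_not fun h => hdb (if_neg h), fun h => hdb (by simp [h])⟩

theorem coeff_X_zero_pow_mul_aeval_X_one (N : ℕ) (P : Polynomial R) :
    coeff e (X 0 ^ N * Polynomial.aeval (X 1) P) = if e 0 = N then P.coeff (e 1) else 0 := by
  induction P using Polynomial.induction_on' with
  | add P Q hP hQ =>
    rw [map_add, mul_add, map_add, hP, hQ, Polynomial.coeff_add]
    split_ifs <;> simp
  | monomial b c =>
    have he : e = Finsupp.single 0 N + Finsupp.single 1 b ↔ e 0 = N ∧ e 1 = b := by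
      simp [Finsupp.ext_iff, Fin.forall_fin_two]
    classical
    rw [Polynomial.aeval_monomial, mul_left_comm, X_pow_eq, X_pow_eq, monomial_mul_monomial,
      ← c_eq_algebraMap, coeff_C_mul, coeff_monomial, Polynomial.coeff_monomial]
    simp only [he, mul_ite, mul_one, mul_zero, ite_and, eq_comm (a := b)]

/-- The pair `(u x ^ p, x ^ q (y + r))` substituted for `(x, y)`. -/
noncomputable def monomialShift (p q : ℕ) (u r : R) : Fin 2 → MvPowerSeries (Fin 2) R :=
  ![C u * X 0 ^ p, X 0 ^ q * (X 1 + C r)]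

theorem hasSubst_monomialShift (hp : 0 < p) (hq : 0 < q) (u r : R) :
    HasSubst (monomialShift p q u r) := by
  refine hasSubst_of_constantCoeff_zero fun i => ?_
  fin_cases i <;> simp [monomialShift, hp.ne', hq.ne']

theorem prod_monomialShift_pow (u r : R) :
    (d.prod fun i n => monomialShift p q u r i ^ n) =
      X 0 ^ (p * d 0 + q * d 1) * Polynomial.aeval (X 1)
        (Polynomial.C (u ^ d 0) * (Polynomial.X + Polynomial.C r) ^ d 1) := by
  rw [Finsupp.prod_fintype _ _ fun i => pow_zero _, Fin.prod_univ_two]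
  simp only [monomialShift, Matrix.cons_val_zero, Matrix.cons_val_one, map_mul, map_pow, map_add,
    Polynomial.aeval_C, Polynomial.aeval_X, ← c_eq_algebraMap, mul_pow, ← pow_mul, pow_add]
  ring

theorem coeff_subst_monomialShift (hp : 0 < p) (hq : 0 < q) (u r : R)
    (f : MvPowerSeries (Fin 2) R) :
    coeff e (subst (monomialShift p q u r) f) =
      ((facePoly p q u (e 0) f).taylor r).coeff (e 1) := by
  rw [coeff_subst (hasSubst_monomialShift hp hq u r)]
  simp only [prod_monomialShift_pow, coeff_X_zero_pow_mul_aeval_X_one, eq_comm (a := e 0)]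
  rw [finsum_eq_sum_of_support_subset (s := face p q (e 0))]
  · rw [facePoly, map_sum, Polynomial.finsetSum_coeff]
    refine Finset.sum_congr rfl fun d hd => ?_
    rw [if_pos (weight_eq_of_mem_face hd), Polynomial.taylor_monomial, Polynomial.coeff_C_mul,
      Polynomial.coeff_C_mul, smul_eq_mul, mul_assoc]
  · intro d hd
    rw [Finset.mem_coe, mem_face hp hq]
    by_contra h
    exact hd (by simp [h])

end Face

theorem coeff_ne_zero_of_natDegree_le_rootMultiplicity {R : Type*} [CommRing R] [IsDomain R]
    [CharZero R] {P : Polynomial R} (hP : P ≠ 0) {r : R} (hr : r ≠ 0)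
    (h : P.natDegree ≤ P.rootMultiplicity r) {b : ℕ} (hb : b ≤ P.rootMultiplicity r) :
    P.coeff b ≠ 0 := by
  obtain ⟨Q, hQ⟩ := P.pow_rootMultiplicity_dvd r
  have hQ₀ : Q ≠ 0 := by rintro rfl; exact hP (by rw [hQ, mul_zero])
  have hdeg : P.natDegree = P.rootMultiplicity r + Q.natDegree := by
    conv_lhs => rw [hQ]
    rw [((Polynomial.monic_X_sub_C r).pow _).natDegree_mul' hQ₀, Polynomial.natDegree_pow,
      Polynomial.natDegree_X_sub_C, mul_one]
  have hQ_const : Q = Polynomial.C (Q.coeff 0) := Polynomial.eq_C_of_natDegree_eq_zero (by omega)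
  have hc : Q.coeff 0 ≠ 0 := fun hc => hQ₀ (by rw [hQ_const, hc, map_zero])
  rw [hQ, hQ_const, Polynomial.coeff_mul_C, sub_eq_add_neg, ← map_neg,
    Polynomial.coeff_X_add_C_pow]
  exact mul_ne_zero (mul_ne_zero (pow_ne_zero _ (neg_ne_zero.2 hr))
    (Nat.cast_ne_zero.2 (Nat.choose_pos hb).ne')) hc

section NewtonMap

variable {σ : NewtonDatum} {f : PS2} {d e : Fin 2 →₀ ℕ}

theorem coprime_p_q (σ : NewtonDatum) : σ.p.Coprime σ.q := by
  have h : σ.p.gcd σ.q ∣ σ.q * σ.q₁ + 1 := σ.bezout ▸ (Nat.gcd_dvd_left _ _).mul_right _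
  exact Nat.dvd_one.1 ((Nat.dvd_add_right ((Nat.gcd_dvd_right _ _).mul_right _)).1 h)

theorem newtonMap_apply (σ : NewtonDatum) (f : PS2) :
    σ.newtonMap f = subst (monomialShift σ.p σ.q (σ.μ ^ σ.q₁) (σ.μ ^ σ.p₁)) f :=
  substAlgHom_apply σ.hasSubst_substitution f

theorem coeff_newtonMap (σ : NewtonDatum) (f : PS2) (e : Fin 2 →₀ ℕ) :
    coeff e (σ.newtonMap f) =
      ((facePoly σ.p σ.q (σ.μ ^ σ.q₁) (e 0) f).taylor (σ.μ ^ σ.p₁)).coeff (e 1) := by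
  rw [newtonMap_apply, coeff_subst_monomialShift σ.p_pos σ.q_pos]

theorem exists_coeff_newtonMap_ne_zero (hd : coeff d f ≠ 0) :
    ∃ e, coeff e (σ.newtonMap f) ≠ 0 ∧ e 0 = σ.p * d 0 + σ.q * d 1 := by
  set N := σ.p * d 0 + σ.q * d 1
  have hface : facePoly σ.p σ.q (σ.μ ^ σ.q₁) N f ≠ 0 := fun h => by
    have := coeff_facePoly_of_mem σ.p_pos ((mem_face σ.p_pos σ.q_pos).2 rfl) (σ.μ ^ σ.q₁) f (d := d)
    rw [h, Polynomial.coeff_zero] at this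
    exact mul_ne_zero hd (pow_ne_zero _ (pow_ne_zero _ σ.μ_ne)) this.symm
  obtain ⟨b, hb⟩ : ∃ b, ((facePoly σ.p σ.q (σ.μ ^ σ.q₁) N f).taylor (σ.μ ^ σ.p₁)).coeff b ≠ 0 := by
    by_contra! h
    exact hface ((Polynomial.taylor_eq_zero _ _).1 (Polynomial.ext h))
  exact ⟨Finsupp.single 0 N + Finsupp.single 1 b, by rw [coeff_newtonMap]; simpa using hb, by simp⟩

theorem newtonMap_ne_zero (σ : NewtonDatum) (hf : f ≠ 0) : σ.newtonMap f ≠ 0 := by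
  obtain ⟨d, hd⟩ := (ne_zero_iff_exists_coeff_ne_zero f).1 hf
  obtain ⟨e, he, -⟩ := exists_coeff_newtonMap_ne_zero (σ := σ) hd
  exact (ne_zero_iff_exists_coeff_ne_zero _).2 ⟨e, he⟩

theorem xOrder_newtonMap_le_weight (hd : coeff d f ≠ 0) :
    xOrder (σ.newtonMap f) ≤ σ.p * d 0 + σ.q * d 1 := by
  obtain ⟨e, he, he₀⟩ := exists_coeff_newtonMap_ne_zero (σ := σ) hd
  exact he₀ ▸ xOrder_le he

theorem xOrder_newtonMap_le (σ : NewtonDatum) (hf : f ≠ 0) :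
    xOrder (σ.newtonMap f) ≤ σ.p * xOrder f + σ.q * yOrder f := by
  obtain ⟨d, hd, hd₀, hd₁⟩ := exists_coeff_ne_zero_of_orders hf
  exact hd₀ ▸ hd₁ ▸ xOrder_newtonMap_le_weight hd

/-- The face polynomial of `f` along the supporting line of slope `-p / q` of its Newton polygon:
its translate by `μ ^ p'` is the coefficient in `ℂ[y]` of the lowest power of `x` in `σ f`. -/
noncomputable def leadingFacePoly (σ : NewtonDatum) (f : PS2) : Polynomial ℂ :=
  facePoly σ.p σ.q (σ.μ ^ σ.q₁) (xOrder (σ.newtonMap f)) f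

theorem coeff_newtonMap_of_eq_xOrder (he : e 0 = xOrder (σ.newtonMap f)) :
    coeff e (σ.newtonMap f) = ((leadingFacePoly σ f).taylor (σ.μ ^ σ.p₁)).coeff (e 1) := by
  rw [coeff_newtonMap, he, leadingFacePoly]

theorem exists_of_coeff_leadingFacePoly_ne_zero {b : ℕ} (hb : (leadingFacePoly σ f).coeff b ≠ 0) :
    ∃ d, coeff d f ≠ 0 ∧ d 1 = b ∧ σ.p * d 0 + σ.q * b = xOrder (σ.newtonMap f) := by
  obtain ⟨d, hd, rfl, hdf⟩ := exists_mem_face_of_coeff_facePoly_ne_zero hb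
  exact ⟨d, hdf, rfl, weight_eq_of_mem_face hd⟩

theorem leadingFacePoly_ne_zero (σ : NewtonDatum) (hf : f ≠ 0) : leadingFacePoly σ f ≠ 0 := by
  obtain ⟨e, he, he₀, -⟩ := exists_coeff_ne_zero_of_orders (newtonMap_ne_zero σ hf)
  rw [coeff_newtonMap_of_eq_xOrder he₀] at he
  exact fun h => he (by rw [h, map_zero, Polynomial.coeff_zero])

theorem natDegree_leadingFacePoly_le (σ : NewtonDatum) (hf : f ≠ 0) :
    (leadingFacePoly σ f).natDegree ≤ yOrder f := by
  refine Polynomial.natDegree_le_iff_coeff_eq_zero.2 fun b hb => ?_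
  by_contra h
  obtain ⟨d, hd, rfl, hN⟩ := exists_of_coeff_leadingFacePoly_ne_zero h
  have hx := Nat.mul_le_mul_left σ.p (xOrder_le hd)
  have hy := Nat.mul_lt_mul_of_pos_left hb σ.q_pos
  have := xOrder_newtonMap_le σ hf
  omega

theorem yOrder_newtonMap (σ : NewtonDatum) (hf : f ≠ 0) :
    yOrder (σ.newtonMap f) = (leadingFacePoly σ f).rootMultiplicity (σ.μ ^ σ.p₁) := by
  rw [Polynomial.rootMultiplicity_eq_natTrailingDegree, ← Polynomial.taylor_apply]
  set T := (leadingFacePoly σ f).taylor (σ.μ ^ σ.p₁)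
  have hT : T ≠ 0 := fun h => leadingFacePoly_ne_zero σ hf ((Polynomial.taylor_eq_zero _ _).1 h)
  apply le_antisymm
  · set e := Finsupp.single (0 : Fin 2) (xOrder (σ.newtonMap f)) +
      Finsupp.single 1 T.natTrailingDegree
    have he₀ : e 0 = xOrder (σ.newtonMap f) := by simp [e]
    have he₁ : e 1 = T.natTrailingDegree := by simp [e]
    rw [← he₁]
    refine yOrder_le ?_ he₀
    rw [coeff_newtonMap_of_eq_xOrder he₀, he₁]
    exact Polynomial.trailingCoeff_nonzero_iff_nonzero.2 hT
  · obtain ⟨e, he, he₀, he₁⟩ := exists_coeff_ne_zero_of_orders (newtonMap_ne_zero σ hf)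
    rw [coeff_newtonMap_of_eq_xOrder he₀] at he
    exact he₁ ▸ Polynomial.natTrailingDegree_le_of_ne_zero he

theorem yOrder_newtonMap_le (σ : NewtonDatum) (hf : f ≠ 0) :
    yOrder (σ.newtonMap f) ≤ yOrder f := by
  rw [yOrder_newtonMap σ hf, ← Polynomial.count_roots]
  exact (Multiset.count_le_card _ _).trans
    ((Polynomial.card_roots' _).trans (natDegree_leadingFacePoly_le σ hf))

section Equality

variable (hf : f ≠ 0) (hy : yOrder (σ.newtonMap f) = yOrder f)
include hf hy

theorem coeff_leadingFacePoly_ne_zero_of_yOrder_eq {b : ℕ} (hb : b ≤ yOrder f) :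
    (leadingFacePoly σ f).coeff b ≠ 0 := by
  have hmult := (yOrder_newtonMap σ hf).symm.trans hy
  exact coeff_ne_zero_of_natDegree_le_rootMultiplicity (leadingFacePoly_ne_zero σ hf)
    (pow_ne_zero _ σ.μ_ne) (hmult ▸ natDegree_leadingFacePoly_le σ hf) (hmult ▸ hb)

theorem xOrder_newtonMap_of_yOrder_eq :
    xOrder (σ.newtonMap f) = σ.p * xOrder f + σ.q * yOrder f := by
  refine (xOrder_newtonMap_le σ hf).antisymm ?_
  obtain ⟨d, hd, -, hN⟩ := exists_of_coeff_leadingFacePoly_ne_zero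
    (coeff_leadingFacePoly_ne_zero_of_yOrder_eq hf hy le_rfl)
  rw [← hN]
  exact Nat.add_le_add_right (Nat.mul_le_mul_left _ (xOrder_le hd)) _

theorem p_eq_one_of_yOrder_eq (hpos : 0 < yOrder f) : σ.p = 1 := by
  obtain ⟨d, -, -, hd⟩ := exists_of_coeff_leadingFacePoly_ne_zero
    (coeff_leadingFacePoly_ne_zero_of_yOrder_eq hf hy le_rfl)
  obtain ⟨d', -, -, hd'⟩ := exists_of_coeff_leadingFacePoly_ne_zero
    (coeff_leadingFacePoly_ne_zero_of_yOrder_eq hf hy (Nat.sub_le (yOrder f) 1))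
  have hq : σ.p * d 0 + σ.q = σ.p * d' 0 := by
    obtain ⟨n, hn⟩ := Nat.exists_eq_succ_of_ne_zero hpos.ne'
    simp only [hn, Nat.succ_sub_one, Nat.mul_succ] at hd hd'
    omega
  have hpq : σ.p ∣ σ.q := (Nat.dvd_add_right (dvd_mul_right _ _)).1 (hq ▸ dvd_mul_right _ _)
  exact (coprime_p_q σ).eq_one_of_dvd hpq

end Equality

end NewtonMap

theorem exists_lt_coeff_ne_zero_of_isRoot {R : Type*} [CommRing R] [IsDomain R]
    {P : Polynomial R} (hP : P ≠ 0) {r : R} (hr : r ≠ 0) (hroot : P.IsRoot r) :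
    ∃ b b', b < b' ∧ P.coeff b ≠ 0 ∧ P.coeff b' ≠ 0 := by
  have hcard : 1 < P.support.card := by
    by_contra! h
    obtain ⟨n, c, rfl⟩ := Polynomial.card_support_le_one_iff_monomial.1 h
    rw [Polynomial.IsRoot, Polynomial.eval_monomial] at hroot
    exact mul_ne_zero (fun hc => hP (by rw [hc, map_zero])) (pow_ne_zero n hr) hroot
  obtain ⟨b, hb, b', hb', hne⟩ := Finset.one_lt_card.1 hcard
  rw [Polynomial.mem_support_iff] at hb hb'
  rcases hne.lt_or_gt with h | h
  exacts [⟨b, b', h, hb, hb'⟩, ⟨b', b, h, hb', hb⟩]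

section Slope

variable {R : Type*} [CommRing R]

/-- The value of `facePoly p q (μ ^ q₁) N f` at `μ ^ p₁`, as a polynomial in `μ`. -/
noncomputable def slopePoly (p q p₁ q₁ N : ℕ) (f : MvPowerSeries (Fin 2) R) :
    Polynomial R :=
  ∑ d ∈ face p q N, Polynomial.monomial (q₁ * d 0 + p₁ * d 1) (coeff d f)

theorem eval_slopePoly (p q p₁ q₁ N : ℕ) (f : MvPowerSeries (Fin 2) R) (μ : R) :
    (slopePoly p q p₁ q₁ N f).eval μ = (facePoly p q (μ ^ q₁) N f).eval (μ ^ p₁) := by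
  simp only [slopePoly, facePoly, Polynomial.eval_finsetSum, Polynomial.eval_monomial]
  refine Finset.sum_congr rfl fun d _ => ?_
  rw [pow_add, pow_mul, pow_mul, mul_assoc]

theorem slopePoly_ne_zero {p q p₁ q₁ N : ℕ} {f : MvPowerSeries (Fin 2) R}
    (hp : 0 < p) (hbez : p * p₁ = q * q₁ + 1)
    {d : Fin 2 →₀ ℕ} (hd : d ∈ face p q N) (hdf : coeff d f ≠ 0) :
    slopePoly p q p₁ q₁ N f ≠ 0 := by
  have hexp : ∀ e ∈ face p q N, p * (q₁ * e 0 + p₁ * e 1) = q₁ * N + e 1 := by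
    intro e he
    rw [← weight_eq_of_mem_face he]
    linear_combination e 1 * hbez
  have hinj : ∀ e ∈ face p q N, q₁ * e 0 + p₁ * e 1 = q₁ * d 0 + p₁ * d 1 → e = d := by
    intro e he h
    have := hexp e he
    rw [h, hexp d hd] at this
    exact face_injOn hp he hd (Nat.add_left_cancel this).symm
  have hcoeff : (slopePoly p q p₁ q₁ N f).coeff (q₁ * d 0 + p₁ * d 1) = coeff d f := by
    simp only [slopePoly, Polynomial.finsetSum_coeff, Polynomial.coeff_monomial]
    rw [Finset.sum_eq_single_of_mem d hd fun e he hed => if_neg fun h => hed (hinj e he h),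
      if_pos rfl]
  intro h
  rw [h, Polynomial.coeff_zero] at hcoeff
  exact hdf hcoeff.symm

end Slope

section Exceptional

variable {σ : NewtonDatum} {f : PS2}

theorem isRoot_leadingFacePoly (hf : f ≠ 0) (hσ : yOrder (σ.newtonMap f) ≠ 0) :
    (leadingFacePoly σ f).IsRoot (σ.μ ^ σ.p₁) := by
  rw [yOrder_newtonMap σ hf] at hσ
  exact (Polynomial.rootMultiplicity_pos (leadingFacePoly_ne_zero σ hf)).1 (Nat.pos_of_ne_zero hσ)

theorem exists_lt_on_leading_face (hf : f ≠ 0) (hσ : yOrder (σ.newtonMap f) ≠ 0) :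
    ∃ d d' : Fin 2 →₀ ℕ, d 1 < d' 1 ∧ d' 1 ≤ yOrder f ∧ coeff d f ≠ 0 ∧
      σ.p * d 0 + σ.q * d 1 = xOrder (σ.newtonMap f) ∧
      σ.p * d' 0 + σ.q * d' 1 = xOrder (σ.newtonMap f) := by
  obtain ⟨b, b', hlt, hb, hb'⟩ := exists_lt_coeff_ne_zero_of_isRoot
    (leadingFacePoly_ne_zero σ hf) (pow_ne_zero _ σ.μ_ne) (isRoot_leadingFacePoly hf hσ)
  have hb'_le := (Polynomial.le_natDegree_of_ne_zero hb').trans (natDegree_leadingFacePoly_le σ hf)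
  obtain ⟨d, hd, rfl, hN⟩ := exists_of_coeff_leadingFacePoly_ne_zero hb
  obtain ⟨d', -, rfl, hN'⟩ := exists_of_coeff_leadingFacePoly_ne_zero hb'
  exact ⟨d, d', hlt, hb'_le, hd, hN, hN'⟩

theorem p_le_and_q_le_of_yOrder_ne_zero (hf : f ≠ 0) (hσ : yOrder (σ.newtonMap f) ≠ 0)
    {e : Fin 2 →₀ ℕ} (he : coeff e f ≠ 0) (hmin : ∀ d, coeff d f ≠ 0 → e 1 ≤ d 1) :
    σ.p ≤ yOrder f ∧ σ.q ≤ e 0 := by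
  obtain ⟨d, d', hlt, hd'_le, hd, hN, hN'⟩ := exists_lt_on_leading_face hf hσ
  obtain ⟨j, hj⟩ := Nat.exists_eq_add_of_lt hlt
  have hd_lt : d' 0 < d 0 := by
    have := Nat.mul_lt_mul_of_pos_left hlt σ.q_pos
    exact lt_of_mul_lt_mul_left (show σ.p * d' 0 < σ.p * d 0 by omega) σ.p.zero_le
  obtain ⟨i, hi⟩ := Nat.exists_eq_add_of_lt hd_lt
  have hsteps : σ.p * (i + 1) = σ.q * (j + 1) := by
    rw [hi] at hN
    rw [hj] at hN'
    linarith
  have hp_le : σ.p ≤ j + 1 :=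
    Nat.le_of_dvd j.succ_pos ((coprime_p_q σ).dvd_of_dvd_mul_left (hsteps ▸ dvd_mul_right _ _))
  have hq_le : σ.q ≤ i + 1 :=
    Nat.le_of_dvd i.succ_pos
      ((coprime_p_q σ).symm.dvd_of_dvd_mul_left (hsteps ▸ dvd_mul_right _ _))
  have hd_le : d 0 ≤ e 0 := by
    have hweight := xOrder_newtonMap_le_weight (σ := σ) he
    have hrow := Nat.mul_le_mul_left σ.q (hmin d hd)
    exact le_of_mul_le_mul_left (show σ.p * d 0 ≤ σ.p * e 0 by omega) σ.p_pos
  omega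

theorem mem_roots_slopePoly (hf : f ≠ 0) (hσ : yOrder (σ.newtonMap f) ≠ 0) :
    σ.μ ∈ (slopePoly σ.p σ.q σ.p₁ σ.q₁ (xOrder (σ.newtonMap f)) f).roots := by
  obtain ⟨d, -, -, -, hd, hN, -⟩ := exists_lt_on_leading_face hf hσ
  have hmem := (mem_face σ.p_pos σ.q_pos).2 hN
  rw [Polynomial.mem_roots (slopePoly_ne_zero σ.p_pos σ.bezout hmem hd), Polynomial.IsRoot,
    eval_slopePoly]
  exact isRoot_leadingFacePoly hf hσ

theorem finite_setOf_yOrder_newtonMap_ne_zero (hf : f ≠ 0) :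
    {σ : NewtonDatum | yOrder (σ.newtonMap f) ≠ 0}.Finite := by
  set S := {σ : NewtonDatum | yOrder (σ.newtonMap f) ≠ 0}
  obtain ⟨e, he, hmin⟩ : ∃ e, coeff e f ≠ 0 ∧ ∀ d, coeff d f ≠ 0 → e 1 ≤ d 1 := by
    obtain ⟨d, hd⟩ := (ne_zero_iff_exists_coeff_ne_zero f).1 hf
    obtain ⟨e, he, hmin⟩ := exists_minimalFor_of_wellFoundedLT (coeff · f ≠ 0) (· 1) ⟨d, hd⟩
    exact ⟨e, he, fun d hd => (le_total (e 1) (d 1)).elim id (hmin hd)⟩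
  have hpq : ∀ σ ∈ S, σ.p ≤ yOrder f ∧ σ.q ≤ e 0 := fun σ hσ =>
    p_le_and_q_le_of_yOrder_ne_zero hf hσ he hmin
  let faceData : NewtonDatum → ℕ × ℕ × ℕ × ℕ × ℕ := fun σ =>
    (σ.p, σ.q, σ.p₁, σ.q₁, xOrder (σ.newtonMap f))
  refine Set.Finite.of_finite_fibers faceData ?_ ?_
  · refine (Set.finite_Iic (yOrder f, e 0, e 0, yOrder f,
      yOrder f * xOrder f + e 0 * yOrder f)).subset ?_
    rintro _ ⟨σ, hσ, rfl⟩
    obtain ⟨hp, hq⟩ := hpq σ hσ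
    exact ⟨hp, hq, σ.p₁_le.trans hq, σ.q₁_lt.le.trans hp, (xOrder_newtonMap_le σ hf).trans <|
      add_le_add (Nat.mul_le_mul_right _ hp) (Nat.mul_le_mul_right _ hq)⟩
  · rintro ⟨p, q, p₁, q₁, N⟩ -
    refine Set.Finite.of_finite_image (f := NewtonDatum.μ)
      ((slopePoly p q p₁ q₁ N f).roots.toFinset.finite_toSet.subset ?_) ?_
    · rintro _ ⟨σ, ⟨hσ, hdata⟩, rfl⟩
      simp only [faceData, Set.mem_preimage, Set.mem_singleton_iff, Prod.mk.injEq] at hdata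
      obtain ⟨rfl, rfl, rfl, rfl, rfl⟩ := hdata
      exact Multiset.mem_toFinset.2 (mem_roots_slopePoly hf hσ)
    · rintro ⟨⟩ ⟨-, h⟩ ⟨⟩ ⟨-, h'⟩ hμ
      simp only [faceData, Set.mem_preimage, Set.mem_singleton_iff, Prod.mk.injEq] at h h'
      obtain ⟨rfl, rfl, rfl, rfl, -⟩ := h
      obtain ⟨rfl, rfl, rfl, rfl, -⟩ := h'
      cases hμ
      rfl

end Exceptional

section Shear

variable {R : Type*} [CommRing R] {g h : PowerSeries R} {q : ℕ}

/-- The inclusion of `R[[x]]` in `R[[x, y]]`. -/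
noncomputable def inX : PowerSeries R →ₐ[R] MvPowerSeries (Fin 2) R :=
  PowerSeries.substAlgHom (PowerSeries.HasSubst.X 0)

theorem inX_apply (h : PowerSeries R) :
    inX h = PowerSeries.subst (X 0 : MvPowerSeries (Fin 2) R) h := by
  rw [inX, PowerSeries.coe_substAlgHom]

theorem inX_X : inX (PowerSeries.X : PowerSeries R) = X 0 := by
  rw [inX_apply, PowerSeries.subst_X (PowerSeries.HasSubst.X 0)]

theorem inX_C (c : R) : inX (PowerSeries.C c) = C c := by
  rw [inX_apply, PowerSeries.subst_C]

theorem coeff_single_zero_inX (h : PowerSeries R) (n : ℕ) :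
    coeff (Finsupp.single 0 n) (inX h) = PowerSeries.coeff n h := by
  rw [inX_apply, PowerSeries.coeff_subst_single, Finsupp.single_eq_same, if_pos rfl]

theorem constantCoeff_inX (h : PowerSeries R) :
    constantCoeff (inX h) = PowerSeries.constantCoeff h := by
  simpa using coeff_single_zero_inX h 0

theorem X_zero_dvd_inX (hh : PowerSeries.X ∣ h) : X 0 ∣ inX h :=
  inX_X (R := R) ▸ map_dvd inX hh

theorem subst_inX {a : Fin 2 → MvPowerSeries (Fin 2) R} (ha : HasSubst a) (ha₀ : a 0 = X 0)
    (h : PowerSeries R) : subst a (inX h) = inX h := by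
  rw [inX_apply, PowerSeries.subst_def, subst_comp_subst_apply (PowerSeries.HasSubst.X 0).const ha]
  simp only [subst_X ha, ha₀]

theorem X_zero_pow_dvd_subst {a : Fin 2 → MvPowerSeries (Fin 2) R} (ha : HasSubst a)
    (ha₀ : a 0 = X 0) {f : MvPowerSeries (Fin 2) R} {k : ℕ} (hf : X 0 ^ k ∣ f) :
    X 0 ^ k ∣ subst a f := by
  obtain ⟨W, rfl⟩ := hf
  rw [subst_mul ha, subst_pow ha, subst_X ha, ha₀]
  exact dvd_mul_right _ _

/-- The pair `(x, y + h(x))` substituted for `(x, y)`. -/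
noncomputable def shear (h : PowerSeries R) : Fin 2 → MvPowerSeries (Fin 2) R :=
  ![X 0, X 1 + inX h]

theorem hasSubst_shear (hh : PowerSeries.X ∣ h) : HasSubst (shear h) := by
  have hconst : constantCoeff (inX h) = 0 := by
    rw [constantCoeff_inX, PowerSeries.X_dvd_iff.1 hh]
  refine hasSubst_of_constantCoeff_zero fun i => ?_
  fin_cases i <;> simp [shear, hconst]

theorem subst_shear_neg_subst_shear (hh : PowerSeries.X ∣ h) (f : MvPowerSeries (Fin 2) R) :
    subst (shear (-h)) (subst (shear h) f) = f := by
  have hs := hasSubst_shear hh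
  have hs' := hasSubst_shear (dvd_neg.2 hh)
  rw [subst_comp_subst_apply hs hs']
  refine Eq.trans ?_ (congrFun subst_self f)
  congr 1
  funext i
  fin_cases i
  · exact subst_X hs' 0
  · change subst (shear (-h)) (X 1 + inX h) = X 1
    rw [subst_add hs', subst_X hs', subst_inX hs' rfl]
    simp [shear]

theorem subst_shear_subst_monomialShift (hq : 0 < q) (μ : R) (hg : PowerSeries.X ∣ g)
    (hh : h = PowerSeries.X ^ q * (PowerSeries.C μ + g)) (f : MvPowerSeries (Fin 2) R) :
    subst (shear g) (subst (monomialShift 1 q 1 μ) f) =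
      subst (monomialShift 1 q 1 0) (subst (shear h) f) := by
  have hh_dvd : PowerSeries.X ∣ h := hh ▸ (dvd_pow_self _ hq.ne').mul_right _
  have hsg := hasSubst_shear hg
  have hsh := hasSubst_shear hh_dvd
  have hμ := hasSubst_monomialShift (R := R) one_pos hq 1 μ
  have h0 := hasSubst_monomialShift (R := R) one_pos hq 1 0
  have h0_zero : monomialShift 1 q 1 0 0 = (X 0 : MvPowerSeries (Fin 2) R) := by
    simp [monomialShift]
  rw [subst_comp_subst_apply hμ hsg, subst_comp_subst_apply hsh h0]
  congr 1
  funext i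
  fin_cases i
  · change subst (shear g) (C 1 * X 0 ^ 1) = subst (monomialShift 1 q 1 0) (X 0)
    rw [map_one, one_mul, pow_one, subst_X hsg, subst_X h0, h0_zero]
    rfl
  · change subst (shear g) (X 0 ^ q * (X 1 + C μ)) = subst (monomialShift 1 q 1 0) (X 1 + inX h)
    rw [subst_add h0, subst_X h0, subst_inX h0 h0_zero, subst_mul hsg, subst_pow hsg,
      subst_add hsg, subst_X hsg, subst_X hsg, subst_C, hh, map_mul, map_pow, map_add, inX_X, inX_C]
    simp only [shear, monomialShift, Matrix.cons_val_zero, Matrix.cons_val_one, map_zero]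
    ring

theorem coeff_subst_monomialShift_one_zero (hq : 0 < q) {d e : Fin 2 →₀ ℕ}
    (he₀ : e 0 = d 0 + q * d 1) (he₁ : e 1 = d 1) (f : MvPowerSeries (Fin 2) R) :
    coeff e (subst (monomialShift 1 q 1 0) f) = coeff d f := by
  have hd : d ∈ face 1 q (e 0) := (mem_face one_pos hq).2 (by rw [he₀, one_mul])
  rw [coeff_subst_monomialShift one_pos hq, Polynomial.taylor_zero, he₁,
    coeff_facePoly_of_mem one_pos hd, one_pow, mul_one]

end Shear

theorem isNewtonFinal_span_singleton {f : PS2} {k ν : ℕ} {h : PowerSeries ℂ}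
    (hh : PowerSeries.X ∣ h) (hf : Associated (X 0 ^ k * (X 1 + inX h) ^ ν) f) :
    (Ideal.span {f}).IsNewtonFinal := by
  obtain ⟨u, rfl⟩ := hf
  exact ⟨k, ν, h, hh, by rw [← inX_apply, Ideal.span_singleton_mul_right_unit u.isUnit]⟩

theorem isNewtonFinal_span_range {ι : Type*} {F : ι → PS2} {k ν : ι → ℕ} {h : PowerSeries ℂ}
    (hh : PowerSeries.X ∣ h) (hF : ∀ i, Associated (X 0 ^ k i * (X 1 + inX h) ^ ν i) (F i))
    {j : ι} (hk : ∀ i, k j ≤ k i) (hν : ∀ i, ν j ≤ ν i) :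
    (Ideal.span (Set.range F)).IsNewtonFinal := by
  have hdvd : ∀ i, F j ∣ F i := fun i =>
    ((hF j).dvd_iff_dvd_left.1 (mul_dvd_mul (pow_dvd_pow _ (hk i)) (pow_dvd_pow _ (hν i)))).trans
      (hF i).dvd
  have hspan : Ideal.span (Set.range F) = Ideal.span {F j} := by
    refine le_antisymm (Ideal.span_le.2 ?_) (Ideal.span_mono (by simp))
    rintro _ ⟨i, rfl⟩
    exact Ideal.mem_span_singleton.2 (hdvd i)
  exact hspan ▸ isNewtonFinal_span_singleton hh (hF j)

theorem exists_eq_span_range.{u} {A : Type u} [CommRing A] [IsNoetherianRing A] {I : Ideal A}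
    (hI : I ≠ ⊥) :
    ∃ (ι : Type u) (_ : Finite ι) (_ : Nonempty ι) (F : ι → A),
      (∀ i, F i ≠ 0) ∧ I = Ideal.span (Set.range F) := by
  classical
  obtain ⟨s, hs⟩ := IsNoetherian.noetherian I
  have hI_eq : I = Ideal.span (s.erase 0 : Finset A) := by
    rw [← hs, Finset.coe_erase, Ideal.span, Submodule.span_sdiff_singleton_zero]
  have hne : (s.erase 0).Nonempty := by
    rw [Finset.nonempty_iff_ne_empty]
    intro h
    exact hI (by rw [hI_eq, h, Finset.coe_empty, Ideal.span_empty])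
  exact ⟨↥(s.erase 0), inferInstance, hne.to_subtype, Subtype.val,
    fun f => Finset.ne_of_mem_erase f.2, by rw [Subtype.range_coe, hI_eq]⟩

theorem newtonTransform_span_range {ι : Type*} (F : ι → PS2) (σ : NewtonDatum) :
    (Ideal.span (Set.range F)).newtonTransform σ =
      Ideal.span (Set.range fun i => σ.newtonMap (F i)) := by
  rw [Ideal.newtonTransform, Ideal.map_span, ← Set.range_comp]
  rfl

/-- The coefficient of `x ^ i` in `branch σ n`. -/
noncomputable def branchCoeff (σ : ℕ → NewtonDatum) (n i : ℕ) : ℂ :=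
  if (σ n).q ≤ i then
    PowerSeries.coeff (i - (σ n).q) (PowerSeries.C (σ n).μ) +
      branchCoeff σ (n + 1) (i - (σ n).q)
  else 0
termination_by i
decreasing_by have := (σ n).q_pos; omega

/-- The series `x ^ qₙ (μₙ + x ^ qₙ₊₁ (μₙ₊₁ + ⋯))`: when all `pₙ` are `1`, the substitution of
`y + branch σ n` for `y` undoes the translations in all the Newton maps `σₙ, σₙ₊₁, …`. -/
noncomputable def branch (σ : ℕ → NewtonDatum) (n : ℕ) : PowerSeries ℂ :=
  PowerSeries.mk (branchCoeff σ n)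

theorem branch_eq (σ : ℕ → NewtonDatum) (n : ℕ) :
    branch σ n = PowerSeries.X ^ (σ n).q * (PowerSeries.C (σ n).μ + branch σ (n + 1)) := by
  ext i
  rw [branch, PowerSeries.coeff_mk, branchCoeff, PowerSeries.coeff_X_pow_mul', map_add, branch,
    PowerSeries.coeff_mk]

theorem X_dvd_branch (σ : ℕ → NewtonDatum) (n : ℕ) : PowerSeries.X ∣ branch σ n :=
  branch_eq σ n ▸ (dvd_pow_self _ (σ n).q_pos.ne').mul_right _

theorem newtonMap_of_p_eq_one {σ : NewtonDatum} (hp : σ.p = 1) (f : PS2) :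
    σ.newtonMap f = subst (monomialShift 1 σ.q 1 σ.μ) f := by
  have hq₁ : σ.q₁ = 0 := by have := σ.q₁_lt; omega
  have hp₁ : σ.p₁ = 1 := by simpa [hp, hq₁] using σ.bezout
  rw [newtonMap_apply, hp, hq₁, hp₁, pow_zero, pow_one]

section Orbit

variable {σ : ℕ → NewtonDatum} {f : ℕ → PS2}

/-- The sequence of transforms of a series along an infinite sequence of Newton maps. -/
def IsNewtonOrbit (σ : ℕ → NewtonDatum) (f : ℕ → PS2) : Prop :=
  ∀ n, f (n + 1) = (σ n).newtonMap (f n)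

theorem IsNewtonOrbit.ne_zero (hf : IsNewtonOrbit σ f) (h₀ : f 0 ≠ 0) (n : ℕ) : f n ≠ 0 := by
  induction n with
  | zero => exact h₀
  | succ n ih => exact hf n ▸ newtonMap_ne_zero _ ih

theorem IsNewtonOrbit.antitone_yOrder (hf : IsNewtonOrbit σ f) (h₀ : f 0 ≠ 0) :
    Antitone fun n => yOrder (f n) :=
  antitone_nat_of_succ_le fun n => (congrArg yOrder (hf n)).trans_le
    (yOrder_newtonMap_le _ (hf.ne_zero h₀ n))

section Constant

variable (hf : IsNewtonOrbit σ f) (h₀ : f 0 ≠ 0) (hν : ∀ n, yOrder (f n) = yOrder (f 0))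
include hf h₀ hν

theorem IsNewtonOrbit.xOrder_succ (n : ℕ) :
    xOrder (f (n + 1)) = (σ n).p * xOrder (f n) + (σ n).q * yOrder (f 0) := by
  have hy : yOrder ((σ n).newtonMap (f n)) = yOrder (f n) := by rw [← hf, hν, hν n]
  rw [hf, xOrder_newtonMap_of_yOrder_eq (hf.ne_zero h₀ n) hy, hν]

theorem IsNewtonOrbit.p_eq_one (hpos : 0 < yOrder (f 0)) (n : ℕ) : (σ n).p = 1 := by
  have hy : yOrder ((σ n).newtonMap (f n)) = yOrder (f n) := by rw [← hf, hν, hν n]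
  exact p_eq_one_of_yOrder_eq (hf.ne_zero h₀ n) hy (hν n ▸ hpos)

theorem IsNewtonOrbit.exists_coeff_shear_branch_ne_zero (hpos : 0 < yOrder (f 0))
    {d : Fin 2 →₀ ℕ} (hd : coeff d (subst (shear (branch σ 0)) (f 0)) ≠ 0)
    (hd₁ : d 1 < yOrder (f 0)) (n : ℕ) :
    ∃ e, coeff e (subst (shear (branch σ n)) (f n)) ≠ 0 ∧ e 1 = d 1 ∧
      e 0 + n + xOrder (f 0) ≤ xOrder (f n) + d 0 := by
  induction n with
  | zero => exact ⟨d, hd, rfl, by omega⟩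
  | succ n ih =>
    obtain ⟨e, he, he₁, hle⟩ := ih
    have hp := hf.p_eq_one h₀ hν hpos n
    refine ⟨Finsupp.single 0 (e 0 + (σ n).q * e 1) + Finsupp.single 1 (e 1), ?_, by simp [he₁], ?_⟩
    · rw [hf, newtonMap_of_p_eq_one hp, subst_shear_subst_monomialShift (σ n).q_pos _
        (X_dvd_branch σ (n + 1)) (branch_eq σ n), coeff_subst_monomialShift_one_zero (σ n).q_pos
        (d := e) (by simp) (by simp)]
      exact he
    · have hstep : (σ n).q * e 1 + 1 ≤ (σ n).q * yOrder (f 0) :=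
        Nat.mul_lt_mul_of_pos_left (he₁ ▸ hd₁) (σ n).q_pos
      have hexp : (Finsupp.single 0 (e 0 + (σ n).q * e 1) + Finsupp.single 1 (e 1) : Fin 2 →₀ ℕ) 0
          = e 0 + (σ n).q * e 1 := by simp
      rw [hf.xOrder_succ h₀ hν, hp, hexp]
      omega

theorem IsNewtonOrbit.X_one_pow_dvd_shear_branch (hpos : 0 < yOrder (f 0)) :
    X 1 ^ yOrder (f 0) ∣ subst (shear (branch σ 0)) (f 0) := by
  refine X_pow_dvd_iff.2 fun d hd₁ => ?_
  by_contra hd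
  obtain ⟨e, he, -, hle⟩ :=
    hf.exists_coeff_shear_branch_ne_zero h₀ hν hpos hd hd₁ (d 0 + 1)
  have hdvd : X 0 ^ xOrder (f (d 0 + 1)) ∣ subst (shear (branch σ (d 0 + 1))) (f (d 0 + 1)) :=
    X_zero_pow_dvd_subst (hasSubst_shear (X_dvd_branch σ _)) rfl
      ((X_zero_pow_dvd_iff (hf.ne_zero h₀ _)).2 le_rfl)
  exact he (X_pow_dvd_iff.1 hdvd e (by omega))

theorem IsNewtonOrbit.associated_branch :
    Associated (X 0 ^ xOrder (f 0) * (X 1 + inX (-branch σ 0)) ^ yOrder (f 0)) (f 0) := by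
  rcases (yOrder (f 0)).eq_zero_or_pos with hzero | hpos
  · simpa only [hzero, pow_zero, mul_one] using associated_X_zero_pow_of_yOrder_eq_zero h₀ hzero
  have hs := hasSubst_shear (X_dvd_branch σ 0)
  have hs' := hasSubst_shear (dvd_neg.2 (X_dvd_branch σ 0))
  have hdvd := map_dvd (substAlgHom hs') (X_zero_pow_mul_X_one_pow_dvd
    (X_zero_pow_dvd_subst hs rfl ((X_zero_pow_dvd_iff h₀).2 le_rfl))
    (hf.X_one_pow_dvd_shear_branch h₀ hν hpos))
  simp only [map_mul, map_pow, coe_substAlgHom, subst_X hs',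
    subst_shear_neg_subst_shear (X_dvd_branch σ 0)] at hdvd
  exact associated_of_X_zero_pow_mul_X_one_add_pow_dvd h₀
    (X_zero_dvd_inX (dvd_neg.2 (X_dvd_branch σ 0))) hdvd

end Constant

end Orbit

section Path

variable {σ : ℕ → NewtonDatum} {f g : ℕ → PS2}

theorem IsNewtonOrbit.add_left (hf : IsNewtonOrbit σ f) (N : ℕ) :
    IsNewtonOrbit (fun n => σ (N + n)) (fun n => f (N + n)) :=
  fun n => hf (N + n)

theorem IsNewtonOrbit.xOrder_le_xOrder (hf : IsNewtonOrbit σ f) (hg : IsNewtonOrbit σ g)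
    (hf₀ : f 0 ≠ 0) (hg₀ : g 0 ≠ 0) (hνf : ∀ n, yOrder (f n) = yOrder (f 0))
    (hνg : ∀ n, yOrder (g n) = yOrder (g 0)) (hν : yOrder (f 0) ≤ yOrder (g 0))
    (hk : xOrder (f 0) ≤ xOrder (g 0)) (n : ℕ) : xOrder (f n) ≤ xOrder (g n) := by
  induction n with
  | zero => exact hk
  | succ n ih =>
    rw [hf.xOrder_succ hf₀ hνf, hg.xOrder_succ hg₀ hνg]
    gcongr

theorem IsNewtonOrbit.xOrder_add_le_xOrder (hf : IsNewtonOrbit σ f) (hg : IsNewtonOrbit σ g)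
    (hf₀ : f 0 ≠ 0) (hg₀ : g 0 ≠ 0) (hνf : ∀ n, yOrder (f n) = yOrder (f 0))
    (hνg : ∀ n, yOrder (g n) = yOrder (g 0)) (hν : yOrder (f 0) < yOrder (g 0)) (n : ℕ) :
    xOrder (f n) + n ≤ xOrder (g n) + xOrder (f 0) := by
  induction n with
  | zero => omega
  | succ n ih =>
    have hgain : (σ n).q * yOrder (f 0) + 1 ≤ (σ n).q * yOrder (g 0) :=
      Nat.mul_lt_mul_of_pos_left hν (σ n).q_pos
    rw [hf.xOrder_succ hf₀ hνf, hg.xOrder_succ hg₀ hνg, hg.p_eq_one hg₀ hνg hν.pos]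
    omega

variable {ι : Type*} [Finite ι] {F : ι → ℕ → PS2}

theorem exists_isNewtonFinal_of_yOrder_eq [Nonempty ι] (hF : ∀ i, IsNewtonOrbit σ (F i))
    (h₀ : ∀ i, F i 0 ≠ 0) (hν : ∀ i n, yOrder (F i n) = yOrder (F i 0)) :
    ∃ n, (Ideal.span (Set.range fun i => F i n)).IsNewtonFinal := by
  obtain ⟨j, hj⟩ := Finite.exists_min fun i => toLex (yOrder (F i 0), xOrder (F i 0))
  let n := xOrder (F j 0)
  have hk : ∀ i, xOrder (F j n) ≤ xOrder (F i n) := by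
    intro i
    rcases Prod.Lex.toLex_le_toLex.1 (hj i) with hlt | ⟨heq, hle⟩
    · have := (hF j).xOrder_add_le_xOrder (hF i) (h₀ j) (h₀ i) (hν j) (hν i) hlt n
      omega
    · exact (hF j).xOrder_le_xOrder (hF i) (h₀ j) (h₀ i) (hν j) (hν i) heq.le hle n
  have hν_min : ∀ i, yOrder (F j n) ≤ yOrder (F i n) := fun i => by
    rw [hν j, hν i]
    exact (Prod.Lex.toLex_le_toLex'.1 (hj i)).1
  exact ⟨n, isNewtonFinal_span_range (dvd_neg.2 (X_dvd_branch (fun m => σ (n + m)) 0))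
    (fun i => ((hF i).add_left n).associated_branch ((hF i).ne_zero (h₀ i) n)
      fun m => (hν i _).trans (hν i n).symm) hk hν_min⟩

theorem exists_forall_yOrder_add_eq (hF : ∀ i, IsNewtonOrbit σ (F i)) (h₀ : ∀ i, F i 0 ≠ 0) :
    ∃ N, ∀ i n, yOrder (F i (N + n)) = yOrder (F i N) := by
  have hstable : ∀ i, ∃ N, ∀ m, N ≤ m → yOrder (F i N) = yOrder (F i m) := fun i =>
    WellFoundedLT.antitone_chain_condition ((hF i).antitone_yOrder (h₀ i))
  choose N hN using hstable
  obtain ⟨M, hM⟩ := (Set.finite_range N).bddAbove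
  refine ⟨M, fun i n => ?_⟩
  have hNM : N i ≤ M := hM ⟨i, rfl⟩
  exact (hN i _ (hNM.trans le_self_add)).symm.trans (hN i M hNM)

theorem exists_isNewtonFinal_of_path {J : ℕ → Ideal PS2} (h₀ : J 0 ≠ ⊥)
    (hJ : ∀ n, J (n + 1) = (J n).newtonTransform (σ n)) : ∃ n, (J n).IsNewtonFinal := by
  obtain ⟨ι, _, _, f, hf, hspan⟩ := exists_eq_span_range h₀
  let F : ι → ℕ → PS2 := fun i n => Nat.rec (f i) (fun m g => (σ m).newtonMap g) n
  have hF : ∀ i, IsNewtonOrbit σ (F i) := fun _ _ => rfl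
  have hJF : ∀ n, J n = Ideal.span (Set.range fun i => F i n) := by
    intro n
    induction n with
    | zero => exact hspan
    | succ n ih => rw [hJ, ih, newtonTransform_span_range]
  obtain ⟨N, hN⟩ := exists_forall_yOrder_add_eq hF hf
  obtain ⟨n, hn⟩ := exists_isNewtonFinal_of_yOrder_eq (fun i => (hF i).add_left N)
    (fun i => (hF i).ne_zero (hf i) N) hN
  exact ⟨N + n, hJF (N + n) ▸ hn⟩

end Path

theorem newtonTransform_ne_bot {I : Ideal PS2} (hI : I ≠ ⊥) (σ : NewtonDatum) :
    I.newtonTransform σ ≠ ⊥ := by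
  obtain ⟨f, hf, hf₀⟩ := Submodule.exists_mem_ne_zero_of_ne_bot hI
  exact Submodule.ne_bot_iff _ |>.2
    ⟨_, Ideal.mem_map_of_mem σ.newtonMap hf, newtonMap_ne_zero σ hf₀⟩

theorem finite_setOf_not_isNewtonFinal {I : Ideal PS2} (hI : I ≠ ⊥) :
    {σ | ¬(I.newtonTransform σ).IsNewtonFinal}.Finite := by
  obtain ⟨ι, _, _, F, hF, rfl⟩ := exists_eq_span_range hI
  refine (Set.finite_iUnion fun i => finite_setOf_yOrder_newtonMap_ne_zero (hF i)).subset
    fun σ hσ => ?_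
  by_contra hy
  have hy : ∀ i, yOrder (σ.newtonMap (F i)) = 0 := fun i => not_not.1 fun hi =>
    hy (Set.mem_iUnion.2 ⟨i, hi⟩)
  obtain ⟨j, hj⟩ := Finite.exists_min fun i => xOrder (σ.newtonMap (F i))
  refine hσ (newtonTransform_span_range F σ ▸
    isNewtonFinal_span_range (k := fun i => xOrder (σ.newtonMap (F i))) (ν := 0)
      (dvd_zero _) (fun i => ?_) hj fun _ => le_rfl)
  simpa using associated_X_zero_pow_of_yOrder_eq_zero (newtonMap_ne_zero σ (hF i)) (hy i)

section Coefficients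

variable {R : Type*} [CommRing R] {h : PowerSeries R}

theorem coeff_single_X_zero_pow_mul (k : ℕ) (f : MvPowerSeries (Fin 2) R) :
    coeff (Finsupp.single 0 k) (X 0 ^ k * f) = constantCoeff f := by
  simpa using coeff_X_zero_pow_mul_X_one_add_pow_mul (W := f) (dvd_zero (X 0)) k 0

theorem coeff_single_one_X_one_add_inX (hh : PowerSeries.X ∣ h) :
    coeff (Finsupp.single 1 1) (X 1 + inX h) = 1 := by
  simpa using coeff_X_zero_pow_mul_X_one_add_pow_mul (W := 1) (X_zero_dvd_inX hh) 0 1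

variable [Nontrivial R]

theorem X_one_add_inX_ne_zero (hh : PowerSeries.X ∣ h) : X 1 + inX h ≠ 0 := by
  intro hzero
  simpa [hzero] using coeff_single_one_X_one_add_inX hh

theorem xOrder_X_one_add_inX (hh : PowerSeries.X ∣ h) :
    xOrder (X 1 + inX h) = 0 := by
  simpa using xOrder_le ((coeff_single_one_X_one_add_inX hh).trans_ne one_ne_zero)

theorem yOrder_X_one_add_inX_le (hh : PowerSeries.X ∣ h) :
    yOrder (X 1 + inX h) ≤ 1 := by
  simpa using yOrder_le ((coeff_single_one_X_one_add_inX hh).trans_ne one_ne_zero)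
    (by simp [xOrder_X_one_add_inX hh])

end Coefficients

theorem exists_eq_newtonMap_X_one_add_inX {σ : NewtonDatum} {h : PowerSeries ℂ}
    (hh : PowerSeries.X ∣ h) (hy : yOrder (σ.newtonMap (X 1 + inX h)) = 1) :
    ∃ g, PowerSeries.X ∣ g ∧ σ.newtonMap (X 1 + inX h) = X 0 ^ σ.q * (X 1 + inX g) := by
  have hne := X_one_add_inX_ne_zero hh
  have hy_eq : yOrder (X 1 + inX h) = 1 := (yOrder_X_one_add_inX_le hh).antisymm
    (hy.symm.trans_le (yOrder_newtonMap_le σ hne))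
  have hp := p_eq_one_of_yOrder_eq hne (hy.trans hy_eq.symm) (by omega)
  have hxσ : xOrder (σ.newtonMap (X 1 + inX h)) = σ.q := by
    rw [xOrder_newtonMap_of_yOrder_eq hne (hy.trans hy_eq.symm), xOrder_X_one_add_inX hh,
      hy_eq, mul_zero, mul_one, zero_add]
  have hexpand : σ.newtonMap (X 1 + inX h) = X 0 ^ σ.q * (X 1 + C σ.μ) + inX h := by
    have hs := hasSubst_monomialShift (R := ℂ) one_pos σ.q_pos 1 σ.μ
    rw [newtonMap_of_p_eq_one hp, subst_add hs, subst_X hs, subst_inX hs (by simp [monomialShift])]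
    rfl
  have hdvd : X 0 ^ σ.q ∣ inX h := by
    have := (X_zero_pow_dvd_iff (newtonMap_ne_zero σ hne)).2 hxσ.ge
    rwa [hexpand, dvd_add_right (dvd_mul_right _ _)] at this
  obtain ⟨g, rfl⟩ : PowerSeries.X ^ σ.q ∣ h := PowerSeries.X_pow_dvd_iff.2 fun m hm => by
    rw [← coeff_single_zero_inX]
    exact X_pow_dvd_iff.1 hdvd _ (by simpa)
  have hfactor : σ.newtonMap (X 1 + inX (PowerSeries.X ^ σ.q * g)) =
      X 0 ^ σ.q * (X 1 + inX (PowerSeries.C σ.μ + g)) := by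
    rw [hexpand, map_mul, map_pow, inX_X, map_add, inX_C]
    ring
  refine ⟨PowerSeries.C σ.μ + g, ?_, hfactor⟩
  have hcoeff : coeff (Finsupp.single 0 σ.q) (σ.newtonMap (X 1 + inX (PowerSeries.X ^ σ.q * g)))
      = 0 := by
    by_contra hcoeff
    have hle := yOrder_le hcoeff (by rw [hxσ, Finsupp.single_eq_same])
    rw [hy, Finsupp.single_eq_of_ne one_ne_zero] at hle
    exact absurd hle one_pos.not_ge
  rw [hfactor, coeff_single_X_zero_pow_mul, map_add, constantCoeff_X, zero_add,
    constantCoeff_inX] at hcoeff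
  exact PowerSeries.X_dvd_iff.2 hcoeff

theorem exists_associated_newtonMap_X_one_add_inX (σ : NewtonDatum) {h : PowerSeries ℂ}
    (hh : PowerSeries.X ∣ h) :
    ∃ (l ν : ℕ) (g : PowerSeries ℂ), PowerSeries.X ∣ g ∧
      Associated (X 0 ^ l * (X 1 + inX g) ^ ν) (σ.newtonMap (X 1 + inX h)) := by
  have hne := X_one_add_inX_ne_zero hh
  have hy : yOrder (σ.newtonMap (X 1 + inX h)) ≤ 1 :=
    (yOrder_newtonMap_le σ hne).trans (yOrder_X_one_add_inX_le hh)
  rcases Nat.le_one_iff_eq_zero_or_eq_one.1 hy with hzero | hone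
  · refine ⟨xOrder (σ.newtonMap (X 1 + inX h)), 0, 0, dvd_zero _, ?_⟩
    simpa using associated_X_zero_pow_of_yOrder_eq_zero (newtonMap_ne_zero σ hne) hzero
  · obtain ⟨g, hg, hgσ⟩ := exists_eq_newtonMap_X_one_add_inX hh hone
    exact ⟨σ.q, 1, g, hg, by rw [hgσ, pow_one]⟩

theorem associated_newtonMap_X_zero (σ : NewtonDatum) :
    Associated (X 0 ^ σ.p) (σ.newtonMap (X 0)) := by
  have hunit : IsUnit (C (σ.μ ^ σ.q₁) : PS2) := (pow_ne_zero _ σ.μ_ne).isUnit.map C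
  rw [newtonMap_apply, subst_X (hasSubst_monomialShift σ.p_pos σ.q_pos _ _)]
  exact (associated_unit_mul_left _ _ hunit).symm

theorem isNewtonFinal_newtonTransform {I : Ideal PS2} (hI : I.IsNewtonFinal) (σ : NewtonDatum) :
    (I.newtonTransform σ).IsNewtonFinal := by
  obtain ⟨k, ν, h, hh, rfl⟩ := hI
  obtain ⟨l, m, g, hg, hgσ⟩ := exists_associated_newtonMap_X_one_add_inX σ hh
  rw [← inX_apply, Ideal.newtonTransform, Ideal.map_span, Set.image_singleton, map_mul, map_pow,
    map_pow]
  refine isNewtonFinal_span_singleton (k := σ.p * k + l * ν) (ν := m * ν) hg ?_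
  have hexponents : (X 0 : PS2) ^ (σ.p * k + l * ν) * (X 1 + inX g) ^ (m * ν) =
      (X 0 ^ σ.p) ^ k * (X 0 ^ l * (X 1 + inX g) ^ m) ^ ν := by
    ring
  rw [hexponents]
  exact (associated_newtonMap_X_zero σ).pow_pow.mul_mul hgσ.pow_pow

theorem isNewtonFinal_newtonTransformSeq {I : Ideal PS2} (hI : I.IsNewtonFinal)
    (S : List NewtonDatum) : (I.newtonTransformSeq S).IsNewtonFinal := by
  induction S generalizing I with
  | nil => exact hI
  | cons σ _ ih => exact ih (isNewtonFinal_newtonTransform hI σ)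

@[elab_as_elim]
theorem newton_induction {P : Ideal PS2 → Prop} (final : ∀ I, I.IsNewtonFinal → P I)
    (step : ∀ I, I ≠ ⊥ → ¬I.IsNewtonFinal → (∀ σ, P (I.newtonTransform σ)) → P I)
    {I : Ideal PS2} (hI : I ≠ ⊥) : P I := by
  by_contra hPI
  have hnext : ∀ J : {J // J ≠ ⊥ ∧ ¬P J}, ∃ σ, ¬P (J.1.newtonTransform σ) := fun J => by
    by_contra! hJ
    exact J.2.2 (step J.1 J.2.1 (fun hfinal => J.2.2 (final _ hfinal)) hJ)
  choose σ hσ using hnext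
  let J : ℕ → {J // J ≠ ⊥ ∧ ¬P J} := fun n =>
    Nat.rec ⟨I, hI, hPI⟩ (fun _ J => ⟨_, newtonTransform_ne_bot J.2.1 (σ J), hσ J⟩) n
  obtain ⟨n, hn⟩ := exists_isNewtonFinal_of_path (J := fun n => (J n).1)
    (σ := fun n => σ (J n)) hI fun _ => rfl
  exact (J n).2.2 (final _ hn)

theorem exists_forall_isNewtonFinal_newtonTransformSeq {I : Ideal PS2} (hI : I ≠ ⊥) :
    ∃ n₀ : ℕ, ∀ S : List NewtonDatum, n₀ ≤ S.length → (I.newtonTransformSeq S).IsNewtonFinal := by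
  refine newton_induction (fun I hI => ⟨0, fun S _ => isNewtonFinal_newtonTransformSeq hI S⟩)
    (fun I hI _ ih => ?_) hI
  choose N hN using ih
  obtain ⟨M, hM⟩ := ((finite_setOf_not_isNewtonFinal hI).image N).bddAbove
  refine ⟨M + 1, fun S hS => ?_⟩
  obtain _ | ⟨σ, S⟩ := S
  · simp at hS
  by_cases hσ : (I.newtonTransform σ).IsNewtonFinal
  · exact isNewtonFinal_newtonTransformSeq hσ S
  · exact hN σ S ((hM ⟨σ, hσ, rfl⟩).trans (Nat.le_of_succ_le_succ hS))

theorem hasNewtonDepth_unique {I : Ideal PS2} {d e : ℕ} (hd : I.HasNewtonDepth d)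
    (he : I.HasNewtonDepth e) : d = e := by
  induction hd generalizing e with
  | zero I hI =>
    cases he with
    | zero => rfl
    | succ _ hI' => exact absurd hI hI'
  | succ I hI D m _ hm ih =>
    cases he with
    | zero _ hI' => exact absurd hI' hI
    | succ _ _ D' m' hD' hm' =>
      obtain rfl : D = D' := funext fun σ => ih σ (hD' σ)
      rw [hm.unique hm']

instance : Nonempty NewtonDatum :=
  ⟨⟨1, 1, 1, 0, 1, one_pos, one_pos, rfl, le_rfl, one_pos, one_ne_zero⟩⟩

theorem exists_hasNewtonDepth {I : Ideal PS2} (hI : I ≠ ⊥) : ∃ d, I.HasNewtonDepth d := by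
  refine newton_induction (fun I hI => ⟨0, .zero I hI⟩) (fun I hI hfinal ih => ?_) hI
  choose D hD using ih
  have hzero : ∀ σ, (I.newtonTransform σ).IsNewtonFinal → D σ = 0 := fun σ hσ =>
    hasNewtonDepth_unique (hD σ) (.zero _ hσ)
  have hfinite : (Set.range D).Finite := by
    refine (((finite_setOf_not_isNewtonFinal hI).image D).insert 0).subset ?_
    rintro _ ⟨σ, rfl⟩
    by_cases hσ : (I.newtonTransform σ).IsNewtonFinal
    · exact Or.inl (hzero σ hσ)
    · exact Or.inr ⟨σ, hσ, rfl⟩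
  have hgreatest : IsGreatest (Set.range D) (sSup (Set.range D)) :=
    ⟨Nat.sSup_mem (Set.range_nonempty D) hfinite.bddAbove, fun _ => le_csSup hfinite.bddAbove⟩
  exact ⟨_, .succ I hfinal D _ hD hgreatest⟩

end NewtonTree

theorem mainTheorem5 (I : Ideal PS2) (hI : I ≠ ⊥) :
    (∃ n₀ : ℕ, ∀ S : List NewtonDatum, n₀ ≤ S.length →
      (I.newtonTransformSeq S).IsNewtonFinal) ∧
    (∃! d : ℕ, I.HasNewtonDepth d) := by
  refine ⟨NewtonTree.exists_forall_isNewtonFinal_newtonTransformSeq hI, ?_⟩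
  obtain ⟨d, hd⟩ := NewtonTree.exists_hasNewtonDepth hI
  exact ⟨d, hd, fun _ he => NewtonTree.hasNewtonDepth_unique he hd⟩
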